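/- Let $(\xi(x))_{x\in\mathbb Z}$ be an i.i.d. family of real random variables on a probability space with measure $\mathbb P$, such that $$0<\operatorname{ess\,inf}\xi(0)<\operatorname{ess\,sup}\xi(0)<\infty .$$ Given a realization of $\xi$ and $x\in\mathbb Z$, consider the following continuous-time branching process. It starts at time $0$ with one particle at $x$. Each particle moves as a continuous-time simple random walk on $\mathbb Z$ with jump rate one and, independently, splits into two particles at rate $\xi(y)$ while it is located at $y$. After a split, the two particles evolve from their common location as independent copies, by the same mechanism. Let $\mathtt P^\xi_x$ be the law of this process for fixed $\xi$, let $M(t)$ be the position of the rightmost particle at time $t\ge 0$, and put $w^y(t,x)=\mathtt P^\xi_x(M(t)\ge y)$ for $y\in\mathbb Z$. Then for every $\varepsilon\in(0,1/2)$ there exists a deterministic $u=u(\varepsilon)\in(0,\infty)$ such that, $\mathbb P$-almost surely, for all $t\ge 0$ and all $y\in\mathbb Z$, $$w^y(t,0)\ge\varepsilon\quad\text{implies}\quad w^y(t+t',0)\ge 1-\varepsilon\ \text{ for all } t'\ge u .$$ -/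

import Mathlib

open MeasureTheory ProbabilityTheory
open scoped ENNReal

namespace BRW

/-- The randomness attached to one stretch of a particle's life, that is, to the time between two
consecutive events (jump or branching): a triple `(J, E, S)`. Here `J` is the jump clock, `E` is
the branching clock before rescaling by the branching rate, and `S` is the displacement. -/
abbrev Mark : Type := ℝ × ℝ × ℤ

/-- The uniform distribution on `{1, -1}`. -/
noncomputable def stepLaw : Measure ℤ :=
  (2⁻¹ : ℝ≥0∞) • Measure.dirac 1 + (2⁻¹ : ℝ≥0∞) • Measure.dirac (-1)

instance instIsProbabilityMeasureStepLaw : IsProbabilityMeasure stepLaw :=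
  ⟨by simp [stepLaw, ENNReal.inv_two_add_inv_two]⟩

instance instIsProbabilityMeasureExp : IsProbabilityMeasure (expMeasure 1) :=
  isProbabilityMeasure_expMeasure one_pos

/-- The law of a mark: `J`, `E`, `S` are independent, `J` and `E` are exponential of rate one,
and `S` is uniform on `{1, -1}`. -/
noncomputable def markLaw : Measure Mark :=
  (expMeasure 1).prod ((expMeasure 1).prod stepLaw)

instance instIsProbabilityMeasureMarkLaw : IsProbabilityMeasure markLaw := by
  unfold markLaw; infer_instance

/-- Sample points of the branching process: one mark for every node of the binary tree. A node is
a finite word in `Bool`, read from the root. -/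
abbrev Sample : Type := List Bool → Mark

/-- All marks are independent with law `markLaw`. -/
noncomputable def law : Measure Sample :=
  Measure.infinitePi (fun _ : List Bool => markLaw)

/-- The marks of the subtree below the child `b` of the root. -/
def subtree (b : Bool) (ω : Sample) : Sample := fun v => ω (b :: v)

/-- A particle that sits at a site with branching rate `r` has two competing independent clocks:
the jump clock `J`, exponential of rate one, and the branching clock `E / r`, exponential of
rate `r`. The particle jumps if the jump clock rings first, and branches otherwise.
The condition `J < E / r` is written without division, so that a branching clock
of rate `r = 0` never rings. -/
def JumpsFirst (r : ℝ) (m : Mark) : Prop := m.1 * r < m.2.1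

open Classical in
/-- The time until the first event (jump or branching), `min J (E / r)`. -/
noncomputable def waitingTime (r : ℝ) (m : Mark) : ℝ :=
  if JumpsFirst r m then m.1 else m.2.1 / r

open Classical in
/-- `position ξ ω v x t` is the position at time `t ≥ 0` of the particle with label `v` in the
branching random walk in the environment `ξ` that starts with one particle at `x` at time `0`;
it is `none` if no particle with this label is present at time `t`.

The starting particle has the empty label and stays at `x` until its first event. If this event
is a jump, then there is one particle after it, located at `x + S`, and it gets the label
`[false]`. If the event is a branching, then there are two particles after it, both at `x`, with
labels `[false]` and `[true]`. From then on, each of these particles evolves in the same way,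
using the independent marks of its own subtree. So a label records the history of a particle, and
a particle receives a new label at each of its events. -/
noncomputable def position (ξ : ℤ → ℝ) : Sample → List Bool → ℤ → ℝ → Option ℤ
  | ω, [], x, t => if t < waitingTime (ξ x) (ω []) then some x else none
  | ω, b :: v, x, t =>
    if t < waitingTime (ξ x) (ω []) then none
    else if JumpsFirst (ξ x) (ω []) then
      if b = false then
        position ξ (subtree b ω) v (x + (ω []).2.2) (t - waitingTime (ξ x) (ω []))
      else none
    else position ξ (subtree b ω) v x (t - waitingTime (ξ x) (ω []))

/-- The set of sites that are occupied at time `t` by a particle of the branching random walk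
in the environment `ξ` started from `x`. -/
def occupied (ξ : ℤ → ℝ) (x : ℤ) (t : ℝ) (ω : Sample) : Set ℤ :=
  {z | ∃ v : List Bool, position ξ ω v x t = some z}

/-- `M(t)`, the position of the rightmost particle at time `t`. The supremum is taken in the
extended reals, so that it has no junk value; when the branching rates are bounded, the number of
particles is almost surely finite and positive and the supremum is a maximum. -/
noncomputable def rightmost (ξ : ℤ → ℝ) (x : ℤ) (t : ℝ) (ω : Sample) : EReal :=
  sSup ((fun z : ℤ => ((z : ℝ) : EReal)) '' occupied ξ x t ω)

/-- `w^y(t, x)`, the probability that `M(t) ≥ y` for the branching random walk in the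
environment `ξ` started from `x`. -/
noncomputable def w (ξ : ℤ → ℝ) (y : ℤ) (t : ℝ) (x : ℤ) : ℝ :=
  law.real {ω | ((y : ℝ) : EReal) ≤ rightmost ξ x t ω}

end BRW

/-! For a fixed environment, conditioning on the first event shows that `w ξ y` solves the discrete
F-KPP equation `∂ₜ w = ½ Δ w + ξ w (1 - w)` (`isKPPSolution_w`). Almost surely all rates exceed one
constant `r > 0`. What remains is a hair-trigger estimate whose time depends only on `r` and `ε`
(`exists_forall_isKPPSolution_le`); restarting at time `t` then makes it uniform in `t` and `y`.

For the estimate, diffusion first spreads the mass `ε` at the origin: after time `L` the solution is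
at least some `a > 0` on `[-L, L]` (`le_of_abs_le`). Then a cosine bump with linearly growing
amplitude lies below the solution (`barrier_le`): for large `L` the diffusive loss `1 - cos θ` is
smaller than the growth rate `r ε`, available as long as the bump stays below `1 - ε`.

For the equation, the avoidance probability `1 - w` satisfies a renewal equation, because the
subtrees are independent of the root mark and of each other (`map_graft`). Its integral form yields
continuity first and differentiability next. -/

namespace BRW

/-! ### Comparison and the hair-trigger effect for the discrete F-KPP equation -/

/-- A solution with values in `[0, 1]` of the discrete F-KPP equation
`∂ₜ w = ½ Δ w + ξ w (1 - w)` on `[0, ∞) × ℤ`. -/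
structure IsKPPSolution (ξ : ℤ → ℝ) (w : ℝ → ℤ → ℝ) : Prop where
  nonneg : ∀ t x, 0 ≤ w t x
  le_one : ∀ t x, w t x ≤ 1
  hasDerivWithinAt : ∀ t, 0 ≤ t → ∀ x, HasDerivWithinAt (fun s => w s x)
    ((w t (x + 1) + w t (x - 1)) / 2 - w t x + ξ x * (w t x * (1 - w t x))) (Set.Ici 0) t

/-- A finite family of functions stays nonnegative if the derivative of each of its members is
positive whenever that member vanishes while all others are nonnegative. -/
lemma nonneg_of_deriv_pos_of_eq_zero {ι : Type*} [Finite ι] {f f' : ι → ℝ → ℝ} {T : ℝ}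
    (h0 : ∀ i, 0 ≤ f i 0)
    (hf : ∀ i s, 0 ≤ s → HasDerivWithinAt (f i) (f' i s) (Set.Ici 0) s)
    (hpos : ∀ s, 0 ≤ s → s < T → (∀ j, 0 ≤ f j s) → ∀ i, f i s = 0 → 0 < f' i s) :
    ∀ s ∈ Set.Icc 0 T, ∀ i, 0 ≤ f i s := by
  have hc : ∀ i, ContinuousOn (f i) (Set.Icc 0 T) := fun i s hs =>
    ((hf i s hs.1).continuousWithinAt).mono Set.Icc_subset_Ici_self
  refine IsClosed.Icc_subset_of_forall_mem_nhdsWithin (s := {s | ∀ i, 0 ≤ f i s}) ?_ h0 ?_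
  · have : {s | ∀ i, 0 ≤ f i s} ∩ Set.Icc 0 T =
        Set.Icc 0 T ∩ ⋂ i, (Set.Icc 0 T ∩ f i ⁻¹' Set.Ici 0) := by
      ext s
      simp only [Set.mem_inter_iff, Set.mem_ofPred_eq, Set.mem_iInter, Set.mem_preimage,
        Set.mem_Ici]
      exact ⟨fun h => ⟨h.2, fun i => ⟨h.2, h.1 i⟩⟩, fun h => ⟨fun i => (h.2 i).2, h.1⟩⟩
    rw [this]
    exact isClosed_Icc.inter
      (isClosed_iInter fun i => (hc i).preimage_isClosed_of_isClosed isClosed_Icc isClosed_Ici)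
  · rintro s ⟨hs, hs0, hsT⟩
    have hsub : Set.Ioi s ⊆ Set.Ici 0 := fun z hz => hs0.trans (le_of_lt hz)
    -- Finiteness of the family gives a common right neighbourhood of `s`.
    refine Filter.eventually_all.2 fun i => ?_
    have hd := (hf i s hs0).mono hsub
    rcases (hs i).eq_or_lt with h | h
    · have hp := hpos s hs0 hsT hs i h.symm
      rw [hasDerivWithinAt_iff_tendsto_slope] at hd
      have hd' := hd.eventually (lt_mem_nhds hp)
      simp only [Set.mem_Ioi, lt_self_iff_false, not_false_eq_true, Set.sdiff_singleton_eq_self]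
        at hd'
      filter_upwards [hd', self_mem_nhdsWithin] with z hz hz'
      have hz' : s < z := hz'
      rw [slope_def_field, ← h, sub_zero] at hz
      have := mul_pos hz (sub_pos.2 hz')
      rw [div_mul_cancel₀ _ (sub_pos.2 hz').ne'] at this
      exact this.le
    · have := hd.continuousWithinAt.eventually (lt_mem_nhds h)
      filter_upwards [this] with z hz using le_of_lt hz

namespace IsKPPSolution

variable {ξ : ℤ → ℝ} {w : ℝ → ℤ → ℝ}

lemma shift (hw : IsKPPSolution ξ w) {t₀ : ℝ} (ht₀ : 0 ≤ t₀) :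
    IsKPPSolution ξ (fun t => w (t₀ + t)) where
  nonneg t := hw.nonneg _
  le_one t := hw.le_one _
  hasDerivWithinAt t ht x := by
    have h := (hw.hasDerivWithinAt (t₀ + t) (by positivity) x)
    have := h.scomp_of_eq (h := fun s => t₀ + s) (s := Set.Ici 0) t
      ((hasDerivAt_id' t).const_add t₀).hasDerivWithinAt
      (fun s hs => add_nonneg ht₀ (Set.mem_Ici.1 hs)) rfl
    simpa [Function.comp_def] using this

/-- The factor `exp t` cancels the loss term `-w`, and the reaction term is nonnegative since `0 ≤ w
≤ 1`; only the inflow from the neighbours is left to compare with `b`. -/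
lemma monotoneOn_exp_mul_sub (hw : IsKPPSolution ξ w) (hξ : ∀ x, 0 ≤ ξ x) (x : ℤ) (b T : ℝ)
    (hb : ∀ t ∈ Set.Ioo 0 T, b ≤ Real.exp t * ((w t (x + 1) + w t (x - 1)) / 2)) :
    MonotoneOn (fun t => Real.exp t * w t x - b * t) (Set.Icc 0 T) := by
  have hd : ∀ t, 0 ≤ t → HasDerivWithinAt (fun t => Real.exp t * w t x - b * t)
      (Real.exp t * w t x + Real.exp t *
      ((w t (x + 1) + w t (x - 1)) / 2 - w t x + ξ x * (w t x * (1 - w t x))) - b)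
      (Set.Ici 0) t := fun t ht => by
    exact (((Real.hasDerivAt_exp t).hasDerivWithinAt.mul
      (hw.hasDerivWithinAt t ht x)).sub
        ((hasDerivAt_id' t).const_mul b).hasDerivWithinAt).congr_deriv (by simp)
  refine monotoneOn_of_hasDerivWithinAt_nonneg (convex_Icc 0 T)
    (fun t ht => ((hd t ht.1).continuousWithinAt).mono Set.Icc_subset_Ici_self)
    (f' := fun t => Real.exp t * w t x + Real.exp t *
      ((w t (x + 1) + w t (x - 1)) / 2 - w t x + ξ x * (w t x * (1 - w t x))) - b) ?_ ?_
  · intro t ht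
    rw [interior_Icc] at ht ⊢
    exact (hd t ht.1.le).mono (fun s hs => hs.1.le)
  · intro t ht
    rw [interior_Icc] at ht
    have h1 := hb t ht
    have h2 : 0 ≤ Real.exp t * (ξ x * (w t x * (1 - w t x))) := by
      have := hw.nonneg t x
      have := sub_nonneg.2 (hw.le_one t x)
      have := hξ x
      positivity
    linarith

lemma le_exp_mul (hw : IsKPPSolution ξ w) (hξ : ∀ x, 0 ≤ ξ x) {x : ℤ} {t : ℝ} (ht : 0 ≤ t) :
    w 0 x ≤ Real.exp t * w t x := by
  have := hw.monotoneOn_exp_mul_sub hξ x 0 t (fun s hs => by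
    have := hw.nonneg s (x + 1)
    have := hw.nonneg s (x - 1)
    positivity) (Set.left_mem_Icc.2 ht) (Set.right_mem_Icc.2 ht) ht
  simpa using this

lemma le_of_adjacent (hw : IsKPPSolution ξ w) (hξ : ∀ x, 0 ≤ ξ x) {x z : ℤ}
    (hz : z + 1 = x ∨ z - 1 = x) : w 0 x / (2 * Real.exp 1) ≤ w 1 z := by
  have := hw.monotoneOn_exp_mul_sub hξ z (w 0 x / 2) 1 (fun s hs => by
    have h1 : w 0 x / 2 ≤ Real.exp s * (w s x / 2) := by
      have := hw.le_exp_mul hξ (x := x) hs.1.le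
      linarith
    refine h1.trans (mul_le_mul_of_nonneg_left ?_ (Real.exp_pos s).le)
    have := hw.nonneg s (z + 1)
    have := hw.nonneg s (z - 1)
    rcases hz with rfl | rfl <;> linarith) (Set.left_mem_Icc.2 zero_le_one)
      (Set.right_mem_Icc.2 zero_le_one) zero_le_one
  simp only [Real.exp_zero, one_mul, mul_zero, sub_zero, mul_one] at this
  have h0 := hw.nonneg 0 z
  rw [div_le_iff₀ (by positivity)]
  linarith

/-- Each unit of time carries the lower bound one site further, or keeps it in place, at the cost of
a factor of at most `2e`. -/
lemma le_of_abs_le (hw : IsKPPSolution ξ w) (hξ : ∀ x, 0 ≤ ξ x) (n : ℕ) :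
    ∀ x : ℤ, |x| ≤ n → w 0 0 * (1 / (2 * Real.exp 1)) ^ n ≤ w n x := by
  induction n with
  | zero => intro x hx; simp only [Nat.cast_zero, abs_nonpos_iff] at hx; simp [hx]
  | succ n ih =>
    intro x hx
    have hs := hw.shift (t₀ := n) (by positivity)
    obtain ⟨z, hz, hxz⟩ : ∃ z : ℤ, |z| ≤ n ∧ (x = z ∨ x + 1 = z ∨ x - 1 = z) := by
      rcases lt_trichotomy x 0 with h | h | h
      · exact ⟨x + 1, by rw [abs_le] at *; push_cast at *; omega, by simp⟩
      · exact ⟨x, by simp [h], by simp⟩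
      · exact ⟨x - 1, by rw [abs_le] at *; push_cast at *; omega, by simp⟩
    have h1 : w n z / (2 * Real.exp 1) ≤ w (n + 1) x := by
      rcases hxz with rfl | h
      · have := hs.le_exp_mul hξ (x := x) zero_le_one
        have h0 := hw.nonneg n x
        simp only [add_zero] at this
        rw [div_le_iff₀ (by positivity)]
        have h1 := hw.nonneg (n + 1) x
        have := Real.exp_pos 1
        nlinarith
      · simpa using hs.le_of_adjacent hξ h
    push_cast
    refine le_trans ?_ h1
    rw [pow_succ, ← mul_assoc, mul_one_div]
    gcongr
    exact ih z hz

/-- The barrier is `b s * cos (θ x)`, with `b` linear from `a` to `A`. The cosine vanishes at `±(L +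
1)` and is an eigenfunction: `½ Δ cos (θ x) = -(1 - cos θ) cos (θ x)`. At a point of contact `w ≤
A`, so the reaction is at least `r (1 - A) w`, and `hslope` makes `w` grow strictly faster than the
barrier. -/
lemma barrier_le (hw : IsKPPSolution ξ w) {r : ℝ} (hr : 0 < r) (hξ : ∀ x, r ≤ ξ x) {L : ℕ}
    {a A T θ : ℝ}
    (hθ : θ = Real.pi / (2 * (L + 1))) (ha : 0 < a) (haA : a ≤ A) (hT : 0 < T)
    (hκ : 1 - Real.cos θ ≤ r * (1 - A))
    (hslope : (A - a) / T < a * (r * (1 - A) - (1 - Real.cos θ)))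
    (h0 : ∀ x : ℤ, |x| ≤ L → a ≤ w 0 x) : A ≤ w T 0 := by
  have hL : (0 : ℝ) < L + 1 := by positivity
  have hθL : θ * (L + 1) = Real.pi / 2 := by rw [hθ]; field_simp
  have hθ0 : 0 < θ := by rw [hθ]; positivity
  clear hθ
  have hφ : ∀ x : ℤ, |x| ≤ L → 0 < Real.cos (θ * x) := fun x hx => by
    have hx' : |(x : ℝ)| ≤ L := by exact_mod_cast hx
    rw [abs_le] at hx'
    apply Real.cos_pos_of_mem_Ioo
    constructor <;> nlinarith
  have hφ0 : ∀ x : ℤ, |x| = L + 1 → Real.cos (θ * x) = 0 := fun x hx => by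
    have hx' : |(x : ℝ)| = L + 1 := by exact_mod_cast hx
    rw [← Real.cos_abs, abs_mul, hx', abs_of_pos hθ0, hθL, Real.cos_pi_div_two]
  set b : ℝ → ℝ := fun s => a + (A - a) / T * s with hb
  have hsl : 0 ≤ (A - a) / T := div_nonneg (sub_nonneg.2 haA) hT.le
  have key := nonneg_of_deriv_pos_of_eq_zero (ι := Finset.Icc (-L : ℤ) L) (T := T)
    (f := fun x s => w s x - b s * Real.cos (θ * (x : ℤ)))
    (f' := fun x s => (w s (x + 1) + w s (x - 1)) / 2 - w s x + ξ x * (w s x * (1 - w s x))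
      - (A - a) / T * Real.cos (θ * (x : ℤ))) ?_ ?_ ?_ T (Set.right_mem_Icc.2 hT.le) ⟨0, by simp⟩
  · simp only [Int.cast_zero, mul_zero, Real.cos_zero, mul_one, hb,
      div_mul_cancel₀ _ hT.ne'] at key
    linarith
  · rintro ⟨x, hx⟩
    rw [Finset.mem_Icc, ← abs_le] at hx
    have := h0 x hx
    have h2 := Real.cos_le_one (θ * x)
    simp only [hb, mul_zero, add_zero]
    nlinarith
  · rintro ⟨x, hx⟩ s hs
    have h1 : HasDerivAt b ((A - a) / T) s := by
      exact (((hasDerivAt_id' s).const_mul ((A - a) / T)).const_add a).congr_deriv (by simp)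
    exact (hw.hasDerivWithinAt s hs x).sub (h1.mul_const _).hasDerivWithinAt
  · rintro s hs hsT hnn ⟨x, hx⟩ heq
    rw [Finset.mem_Icc, ← abs_le] at hx
    have hsT' : (A - a) / T * s ≤ A - a := by
      calc (A - a) / T * s ≤ (A - a) / T * T := by gcongr
        _ = A - a := div_mul_cancel₀ _ hT.ne'
    have hba : a ≤ b s := by simp only [hb]; nlinarith
    have hbA : b s ≤ A := by simp only [hb]; linarith
    -- Neighbours of the interval are included: there the barrier is zero.
    have hnb : ∀ z : ℤ, |z| ≤ L + 1 → b s * Real.cos (θ * z) ≤ w s z := fun z hz => by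
      rcases hz.eq_or_lt with h | h
      · rw [hφ0 z h, mul_zero]; exact hw.nonneg _ _
      · have h := Int.lt_add_one_iff.1 h
        have := hnn ⟨z, by rw [Finset.mem_Icc, ← abs_le]; exact h⟩
        simpa using this
    have h1 := hnb (x + 1) ((abs_add_le _ _).trans (by simpa using hx))
    have h2 := hnb (x - 1) ((abs_sub _ _).trans (by simpa using hx))
    have hφx := hφ x hx
    have hsum : Real.cos (θ * (x + 1 : ℤ)) + Real.cos (θ * (x - 1 : ℤ)) =
        2 * Real.cos θ * Real.cos (θ * x) := by
      push_cast
      rw [mul_add, mul_sub, mul_one, Real.cos_add, Real.cos_sub]; ring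
    have hφ1 := Real.cos_le_one (θ * x)
    set φ := Real.cos (θ * x)
    have hwx : w s x = b s * φ := by simpa [sub_eq_zero] using heq
    have hsum' : b s * (2 * Real.cos θ * φ) ≤ w s (x + 1) + w s (x - 1) := by
      rw [← hsum, mul_add]; exact add_le_add h1 h2
    have hbφ : b s * φ ≤ A := by nlinarith
    have hr' : r * (w s x * (1 - A)) ≤ ξ x * (w s x * (1 - w s x)) := by
      have e1 := hw.nonneg s x
      have e2 := hw.le_one s x
      rw [hwx] at e1 e2 ⊢
      have : r * (b s * φ * (1 - A)) ≤ r * (b s * φ * (1 - b s * φ)) := by gcongr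
      refine this.trans (mul_le_mul_of_nonneg_right (hξ x) (mul_nonneg e1 (by linarith)))
    have hfin : (A - a) / T * φ < b s * φ * (r * (1 - A) - (1 - Real.cos θ)) := by
      have : a * (r * (1 - A) - (1 - Real.cos θ)) ≤ b s * (r * (1 - A) - (1 - Real.cos θ)) := by
        apply mul_le_mul_of_nonneg_right hba (by linarith)
      nlinarith
    rw [hwx] at hr' ⊢
    simp only [sub_pos]
    nlinarith

end IsKPPSolution

/-- The hair-trigger effect: the time it takes a solution to grow from `ε` to `1 - ε` at the
origin is bounded in terms of a lower bound on the reaction rates. -/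
theorem exists_forall_isKPPSolution_le {r ε : ℝ} (hr : 0 < r) (hε : 0 < ε) (hε' : ε < 1 / 2) :
    ∃ u : ℝ, 0 < u ∧ ∀ (ξ : ℤ → ℝ) (w : ℝ → ℤ → ℝ), (∀ x, r ≤ ξ x) → IsKPPSolution ξ w →
      ε ≤ w 0 0 → ∀ t, u ≤ t → 1 - ε ≤ w t 0 := by
  obtain ⟨L, hL⟩ : ∃ L : ℕ, 1 - Real.cos (Real.pi / (2 * (L + 1))) < r * ε / 2 := by
    have h1 : Filter.Tendsto (fun L : ℕ => 1 - Real.cos (Real.pi / 2 * (1 / ((L : ℝ) + 1))))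
        Filter.atTop (nhds (1 - Real.cos (Real.pi / 2 * 0))) :=
      (((Real.continuous_cos.tendsto _).comp
        (tendsto_one_div_add_atTop_nhds_zero_nat.const_mul (Real.pi / 2))).const_sub 1)
    rw [mul_zero, Real.cos_zero, sub_self] at h1
    obtain ⟨L, hL⟩ := (h1.eventually (gt_mem_nhds (show 0 < r * ε / 2 by positivity))).exists
    rw [mul_one_div, div_div] at hL
    exact ⟨L, hL⟩
  set a := ε * (1 / (2 * Real.exp 1)) ^ L with ha
  have ha0 : 0 < a := by positivity
  have haε : a ≤ ε := by
    refine mul_le_of_le_one_right hε.le (pow_le_one₀ (by positivity) ?_)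
    rw [div_le_one (by positivity)]
    have := Real.add_one_le_exp 1
    linarith
  -- Time `L` for spreading, then enough time for the amplitude to climb from `a` to `1 - ε` at a
  -- slope below `a r ε / 2`. Taking `T = t - L` adapts the slope to `t`, so later times need no
  -- monotonicity of `w` in time.
  refine ⟨L + 2 / (a * (r * ε)), by positivity, fun ξ w hξ hw h0 t ht => ?_⟩
  have hξ0 : ∀ x, 0 ≤ ξ x := fun x => hr.le.trans (hξ x)
  have hs := hw.shift (t₀ := L) (by positivity)
  have hT0 : 0 < 2 / (a * (r * ε)) := by positivity
  have hT : 2 / (a * (r * ε)) ≤ t - L := le_sub_iff_add_le'.2 ht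
  have hTp : 0 < t - L := hT0.trans_le hT
  have := hs.barrier_le hr hξ (A := 1 - ε) (a := a) (T := t - L) rfl ha0 (by linarith)
    hTp (by rw [sub_sub_cancel]; linarith [mul_pos hr hε]) ?_ ?_
  · simpa using this
  · rw [div_le_iff₀ (by positivity)] at hT
    rw [div_lt_iff₀ hTp]
    have : a * (r * ε / 2) * (t - L) ≤ a * (r * (1 - (1 - ε)) -
        (1 - Real.cos (Real.pi / (2 * ((L : ℝ) + 1))))) * (t - L) := by
      gcongr
      linarith
    refine lt_of_lt_of_le ?_ this
    have h2 : a * (r * ε / 2) * (t - L) = (t - L) * (a * (r * ε)) / 2 := by ring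
    rw [h2]
    linarith
  · intro x hx
    simp only [add_zero]
    exact (mul_le_mul_of_nonneg_right h0 (by positivity)).trans (hw.le_of_abs_le hξ0 L x hx)

/-! ### First-event decomposition and measurability -/

/-- Some particle of the branching random walk started from `x` is at or to the right of `y` at
time `t`. -/
def Reaches (ξ : ℤ → ℝ) (y x : ℤ) (t : ℝ) (ω : Sample) : Prop :=
  ∃ v : List Bool, ∃ z, y ≤ z ∧ position ξ ω v x t = some z

lemma le_rightmost_iff {ξ : ℤ → ℝ} {y x : ℤ} {t : ℝ} {ω : Sample} :
    ((y : ℝ) : EReal) ≤ rightmost ξ x t ω ↔ Reaches ξ y x t ω := by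
  constructor
  · intro h
    -- The supremum need not be attained; a particle strictly beyond `y - 1` suffices, as positions
    -- are integers.
    have h1 : (((y : ℝ) - 1 : ℝ) : EReal) < rightmost ξ x t ω :=
      lt_of_lt_of_le (EReal.coe_lt_coe_iff.2 (by linarith)) h
    obtain ⟨_, ⟨z, ⟨v, hv⟩, rfl⟩, hz⟩ := lt_sSup_iff.1 h1
    refine ⟨v, z, ?_, hv⟩
    have h2 := EReal.coe_lt_coe_iff.1 hz
    have h3 : y - 1 < z := by exact_mod_cast h2
    omega
  · rintro ⟨v, z, hyz, hv⟩
    refine le_trans ?_ (le_sSup ⟨z, ⟨v, hv⟩, rfl⟩)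
    exact EReal.coe_le_coe_iff.2 (by exact_mod_cast hyz)

open Classical in
lemma reaches_iff {ξ : ℤ → ℝ} {y x : ℤ} {t : ℝ} {ω : Sample} :
    Reaches ξ y x t ω ↔
      if t < waitingTime (ξ x) (ω []) then y ≤ x
      else if JumpsFirst (ξ x) (ω []) then
        Reaches ξ y (x + (ω []).2.2) (t - waitingTime (ξ x) (ω [])) (subtree false ω)
      else Reaches ξ y x (t - waitingTime (ξ x) (ω [])) (subtree false ω) ∨
        Reaches ξ y x (t - waitingTime (ξ x) (ω [])) (subtree true ω) := by
  have hsplit : Reaches ξ y x t ω ↔ (∃ z, y ≤ z ∧ position ξ ω [] x t = some z) ∨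
      (∃ v z, y ≤ z ∧ position ξ ω (false :: v) x t = some z) ∨
      (∃ v z, y ≤ z ∧ position ξ ω (true :: v) x t = some z) := by
    constructor
    · rintro ⟨_ | ⟨_ | _, v⟩, z, h⟩
      exacts [.inl ⟨z, h⟩, .inr (.inl ⟨v, z, h⟩), .inr (.inr ⟨v, z, h⟩)]
    · rintro (⟨z, h⟩ | ⟨v, z, h⟩ | ⟨v, z, h⟩) <;> exact ⟨_, z, h⟩
  rw [hsplit]
  simp only [position]
  split_ifs <;> simp_all [Reaches]

lemma measurable_subtree (b : Bool) : Measurable (subtree b) :=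
  measurable_pi_lambda _ fun v => measurable_pi_apply (b :: v)

lemma measurableSet_jumpsFirst (r : ℝ) : MeasurableSet {m : Mark | JumpsFirst r m} :=
  measurableSet_lt (by fun_prop) (by fun_prop)

lemma measurable_waitingTime (r : ℝ) : Measurable (waitingTime r) := by
  classical
  exact Measurable.ite (measurableSet_jumpsFirst r) (by fun_prop) (by fun_prop)

/-- Joint measurability in time and sample is needed because the recursion evaluates the subtree at
a random remaining time. -/
lemma measurableSet_position_eq (ξ : ℤ → ℝ) (v : List Bool) :
    ∀ x z : ℤ, MeasurableSet {p : ℝ × Sample | position ξ p.2 v x p.1 = some z} := by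
  have hroot : Measurable fun p : ℝ × Sample => p.2 [] :=
    (measurable_pi_apply _).comp measurable_snd
  have hτ : ∀ x, Measurable fun p : ℝ × Sample => waitingTime (ξ x) (p.2 []) := fun x =>
    (measurable_waitingTime _).comp hroot
  have hA : ∀ x, MeasurableSet {p : ℝ × Sample | p.1 < waitingTime (ξ x) (p.2 [])} := fun x =>
    measurableSet_lt measurable_fst (hτ x)
  induction v with
  | nil =>
    intro x z
    have : {p : ℝ × Sample | position ξ p.2 [] x p.1 = some z} =
        {p | p.1 < waitingTime (ξ x) (p.2 [])} ∩ {_p | x = z} := by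
      ext p
      simp only [Set.mem_ofPred_eq, Set.mem_inter_iff, position]
      split_ifs with h <;> simp [h]
    rw [this]
    exact (hA x).inter (MeasurableSet.const _)
  | cons b v ih =>
    intro x z
    have hJ : MeasurableSet {p : ℝ × Sample | JumpsFirst (ξ x) (p.2 [])} :=
      hroot (measurableSet_jumpsFirst (ξ x))
    have hs : Measurable fun p : ℝ × Sample =>
        (p.1 - waitingTime (ξ x) (p.2 []), subtree b p.2) :=
      (measurable_fst.sub (hτ x)).prodMk ((measurable_subtree b).comp measurable_snd)
    have hS : ∀ k : ℤ, MeasurableSet {p : ℝ × Sample | (p.2 []).2.2 = k} := fun k =>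
      (measurable_snd.comp (measurable_snd.comp hroot)) (measurableSet_singleton k)
    -- The site after a jump is random, so the event is split over the countably many displacements
    -- `k`.
    have : {p : ℝ × Sample | position ξ p.2 (b :: v) x p.1 = some z} =
        {p | p.1 < waitingTime (ξ x) (p.2 [])}ᶜ ∩
        (({p | JumpsFirst (ξ x) (p.2 [])} ∩ ({_p | b = false} ∩
          ⋃ k : ℤ, {p | (p.2 []).2.2 = k} ∩
            (fun p : ℝ × Sample => (p.1 - waitingTime (ξ x) (p.2 []), subtree b p.2)) ⁻¹'
              {p | position ξ p.2 v (x + k) p.1 = some z})) ∪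
        ({p | JumpsFirst (ξ x) (p.2 [])}ᶜ ∩
          (fun p : ℝ × Sample => (p.1 - waitingTime (ξ x) (p.2 []), subtree b p.2)) ⁻¹'
              {p | position ξ p.2 v x p.1 = some z})) := by
      ext p
      simp only [Set.mem_ofPred_eq, Set.mem_inter_iff, position, Set.mem_union, Set.mem_compl_iff,
        Set.mem_iUnion, Set.mem_preimage]
      split_ifs <;> simp_all
    rw [this]
    exact (hA x).compl.inter ((hJ.inter ((MeasurableSet.const _).inter
      (MeasurableSet.iUnion fun k => (hS k).inter (hs (ih _ _))))).union
      (hJ.compl.inter (hs (ih _ _))))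

lemma measurableSet_reaches (ξ : ℤ → ℝ) (y x : ℤ) :
    MeasurableSet {p : ℝ × Sample | Reaches ξ y x p.1 p.2} := by
  have : {p : ℝ × Sample | Reaches ξ y x p.1 p.2} =
      ⋃ v : List Bool, ⋃ z : ℤ, {_p | y ≤ z} ∩ {p | position ξ p.2 v x p.1 = some z} := by
    ext p; simp [Reaches]
  rw [this]
  exact .iUnion fun v => .iUnion fun z =>
    (MeasurableSet.const _).inter (measurableSet_position_eq ξ v x z)

/-! ### Independence of the root mark and the two subtrees -/

/-- The sample point with a given mark at the root and given subtrees below it. -/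
def graft (p : Mark × Sample × Sample) : Sample
  | [] => p.1
  | false :: v => p.2.1 v
  | true :: v => p.2.2 v

lemma measurable_graft : Measurable graft := by
  refine measurable_pi_lambda _ fun v => ?_
  rcases v with _ | ⟨_ | _, v⟩
  · exact measurable_fst
  · exact (measurable_pi_apply v).comp (measurable_fst.comp measurable_snd)
  · exact (measurable_pi_apply v).comp (measurable_snd.comp measurable_snd)

instance instIsProbabilityMeasureLaw : IsProbabilityMeasure law := by
  unfold law; infer_instance

/-- The mark at the root and the two subtrees below it are independent. -/
lemma map_graft : (markLaw.prod (law.prod law)).map graft = law := by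
  classical
  refine Measure.eq_infinitePi _ fun s t ht => ?_
  set t' : List Bool → Set Mark := fun v => if v ∈ s then t v else Set.univ with ht'
  have htm : ∀ v, MeasurableSet (t' v) := fun v => by
    simp only [ht']; split_ifs; exacts [ht v, .univ]
  -- The index set is enlarged to the root and the same finite set `a` below both children, so that
  -- the preimage of the cylinder is a product. The added coordinates carry `univ`, a factor one.
  set a := s.image List.tail with ha
  set s' : Finset (List Bool) :=
    insert [] (a.image (List.cons false) ∪ a.image (List.cons true)) with hs'
  have hss : s ⊆ s' := by
    intro v hv
    rcases v with _ | ⟨_ | _, v⟩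
    · simp [hs']
    · simp only [hs', Finset.mem_insert, Finset.mem_union, Finset.mem_image]
      exact .inr (.inl ⟨v, Finset.mem_image.2 ⟨_, hv, rfl⟩, rfl⟩)
    · simp only [hs', Finset.mem_insert, Finset.mem_union, Finset.mem_image]
      exact .inr (.inr ⟨v, Finset.mem_image.2 ⟨_, hv, rfl⟩, rfl⟩)
  have hprod : ∏ i ∈ s, markLaw (t i) = ∏ i ∈ s', markLaw (t' i) := by
    rw [← Finset.prod_subset hss (fun v _ hv => by simp [ht', hv])]
    exact Finset.prod_congr rfl fun v hv => by simp [ht', hv]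
  have hpi : graft ⁻¹' (Set.pi s t) = t' [] ×ˢ
      (Set.pi a (fun v => t' (false :: v)) ×ˢ Set.pi a (fun v => t' (true :: v))) := by
    have h1 : Set.pi (s : Set (List Bool)) t = Set.pi s' t' := by
      ext f
      simp only [Set.mem_pi, Finset.mem_coe]
      refine ⟨fun h v _ => ?_, fun h v hv => ?_⟩
      · by_cases hv : v ∈ s
        · simpa [ht', hv] using h v hv
        · simp [ht', hv]
      · simpa [ht', hv] using h v (hss hv)
    rw [h1]
    ext ⟨m, ω₀, ω₁⟩
    simp only [Set.mem_preimage, Set.mem_pi, Finset.mem_coe, hs', Finset.mem_insert,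
      Finset.mem_union, Finset.mem_image, Set.mem_prod]
    constructor
    · intro h
      exact ⟨h [] (.inl rfl), fun v hv => h (false :: v) (.inr (.inl ⟨v, hv, rfl⟩)),
        fun v hv => h (true :: v) (.inr (.inr ⟨v, hv, rfl⟩))⟩
    · rintro ⟨h0, h1, h2⟩ v (rfl | ⟨v, hv, rfl⟩ | ⟨v, hv, rfl⟩)
      exacts [h0, h1 v hv, h2 v hv]
  clear_value a
  rw [Measure.map_apply measurable_graft (.pi s.countable_toSet fun v _ => ht v), hpi,
    Measure.prod_prod, Measure.prod_prod, law, Measure.infinitePi_pi _ fun v _ => htm _,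
    Measure.infinitePi_pi _ fun v _ => htm _, hprod, hs', Finset.prod_insert (by simp),
    Finset.prod_union, Finset.prod_image, Finset.prod_image]
  · exact fun _ _ _ _ h => (List.cons.inj h).2
  · exact fun _ _ _ _ h => (List.cons.inj h).2
  · rw [Finset.disjoint_left]
    simp

/-! ### The renewal equation -/

/-- The probability that no particle is at or to the right of `y` at time `t`. -/
noncomputable def avoid (ξ : ℤ → ℝ) (y : ℤ) (t : ℝ) (x : ℤ) : ℝ :=
  law.real {ω | ¬ Reaches ξ y x t ω}

lemma avoid_nonneg (ξ : ℤ → ℝ) (y : ℤ) (t : ℝ) (x : ℤ) : 0 ≤ avoid ξ y t x :=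
  measureReal_nonneg

lemma avoid_le_one (ξ : ℤ → ℝ) (y : ℤ) (t : ℝ) (x : ℤ) : avoid ξ y t x ≤ 1 :=
  measureReal_le_one

lemma measurable_avoid (ξ : ℤ → ℝ) (y x : ℤ) : Measurable fun t => avoid ξ y t x :=
  (measurable_measure_prodMk_left (ν := law) (measurableSet_reaches ξ y x).compl).ennreal_toReal

lemma w_eq_one_sub_avoid (ξ : ℤ → ℝ) (y : ℤ) (t : ℝ) (x : ℤ) :
    w ξ y t x = 1 - avoid ξ y t x := by
  have hm : MeasurableSet {ω | Reaches ξ y x t ω} :=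
    measurable_prodMk_left (measurableSet_reaches ξ y x)
  have := probReal_compl_eq_one_sub (μ := law) hm
  have h2 : {ω | Reaches ξ y x t ω}ᶜ = {ω | ¬ Reaches ξ y x t ω} := rfl
  simp only [w, le_rightmost_iff, avoid]
  rw [← h2, this]
  ring

open Classical in
/-- The renewal equation at the first event. -/
lemma avoid_eq_integral (ξ : ℤ → ℝ) (y : ℤ) (t : ℝ) (x : ℤ) :
    avoid ξ y t x = ∫ m, (if t < waitingTime (ξ x) m then (if y ≤ x then 0 else 1)
      else if JumpsFirst (ξ x) m then avoid ξ y (t - waitingTime (ξ x) m) (x + m.2.2)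
      else avoid ξ y (t - waitingTime (ξ x) m) x ^ 2) ∂markLaw := by
  have hm : MeasurableSet {ω | ¬ Reaches ξ y x t ω} :=
    (measurable_prodMk_left (measurableSet_reaches ξ y x)).compl
  have h1 : law {ω | ¬ Reaches ξ y x t ω} = ∫⁻ m, (law.prod law)
      (Prod.mk m ⁻¹' (graft ⁻¹' {ω | ¬ Reaches ξ y x t ω})) ∂markLaw := by
    conv_lhs => rw [← map_graft]
    rw [Measure.map_apply measurable_graft hm, Measure.prod_apply (measurable_graft hm)]
  rw [avoid, Measure.real, h1, ← integral_toReal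
    (measurable_measure_prodMk_left (measurable_graft hm)).aemeasurable
    (.of_forall fun _ => measure_lt_top _ _)]
  refine integral_congr_ae (.of_forall fun m => ?_)
  simp only
  have hsub : ∀ ω₀ ω₁ : Sample, subtree false (graft (m, ω₀, ω₁)) = ω₀ ∧
      subtree true (graft (m, ω₀, ω₁)) = ω₁ ∧ graft (m, ω₀, ω₁) [] = m :=
    fun ω₀ ω₁ => ⟨rfl, rfl, rfl⟩
  have hpre : Prod.mk m ⁻¹' (graft ⁻¹' {ω | ¬ Reaches ξ y x t ω}) =
      {q : Sample × Sample | ¬ if t < waitingTime (ξ x) m then y ≤ x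
      else if JumpsFirst (ξ x) m then
        Reaches ξ y (x + m.2.2) (t - waitingTime (ξ x) m) q.1
      else Reaches ξ y x (t - waitingTime (ξ x) m) q.1 ∨
        Reaches ξ y x (t - waitingTime (ξ x) m) q.2} := by
    ext ⟨ω₀, ω₁⟩
    simp only [Set.mem_preimage, Set.mem_ofPred_eq]
    rw [reaches_iff]
    simp only [hsub]
  rw [hpre]
  split_ifs with h1 h2 h3
  · simp [h2, -not_le]
  · simp [h2, -not_le]
  · have : {q : Sample × Sample | ¬ Reaches ξ y (x + m.2.2) (t - waitingTime (ξ x) m) q.1} =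
      {ω | ¬ Reaches ξ y (x + m.2.2) (t - waitingTime (ξ x) m) ω} ×ˢ Set.univ := by
      ext; simp
    rw [this, Measure.prod_prod, measure_univ, mul_one]
    rfl
  -- After a branching both independent subtrees must avoid the half-line, hence the square.
  · have : {q : Sample × Sample | ¬ (Reaches ξ y x (t - waitingTime (ξ x) m) q.1 ∨
        Reaches ξ y x (t - waitingTime (ξ x) m) q.2)} =
      {ω | ¬ Reaches ξ y x (t - waitingTime (ξ x) m) ω} ×ˢ
        {ω | ¬ Reaches ξ y x (t - waitingTime (ξ x) m) ω} := by
      ext; simp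
    rw [this, Measure.prod_prod, ENNReal.toReal_mul, sq]
    rfl

/-! ### Integration over the exponential clocks -/

lemma intervalIntegrable_exp_mul {k : ℝ → ℝ} (hk : Measurable k) {C : ℝ}
    (hC : ∀ s, |k s| ≤ C) (l a b : ℝ) :
    IntervalIntegrable (fun s => Real.exp (l * s) * k s) volume a b := by
  have hc : Continuous fun s => Real.exp (l * s) * C := by fun_prop
  have he : Continuous fun s => Real.exp (l * s) := by fun_prop
  refine (hc.intervalIntegrable a b).mono_fun' (he.measurable.mul hk).aestronglyMeasurable
    (.of_forall fun s => ?_)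
  simp only
  rw [norm_mul, Real.norm_of_nonneg (Real.exp_pos _).le]
  exact mul_le_mul_of_nonneg_left (hC s) (Real.exp_pos _).le

lemma integral_expMeasure_one (f : ℝ → ℝ) :
    ∫ s, f s ∂expMeasure 1 = ∫ s in Set.Ioi 0, Real.exp (-s) * f s := by
  have h : expMeasure 1 = volume.withDensity (exponentialPDF 1) := rfl
  rw [h, integral_withDensity_eq_integral_toReal_smul
    (f := exponentialPDF 1) (measurable_exponentialPDFReal 1).ennreal_ofReal
    (.of_forall fun _ => ENNReal.ofReal_lt_top),
    ← integral_Ici_eq_integral_Ioi, ← integral_indicator measurableSet_Ici]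
  refine integral_congr_ae (.of_forall fun s => ?_)
  simp only [exponentialPDF_eq, one_mul, smul_eq_mul, Set.indicator, Set.mem_Ici]
  split_ifs with hs
  · rw [ENNReal.toReal_ofReal (Real.exp_pos _).le]
  · simp

instance instNullSingletonClassExpMeasure : NullSingletonClass (expMeasure 1) := by
  have h : expMeasure 1 = volume.withDensity (exponentialPDF 1) := rfl
  rw [h]
  infer_instance

lemma expMeasure_one_real_Ioi {a : ℝ} (ha : 0 ≤ a) :
    (expMeasure 1).real (Set.Ioi a) = Real.exp (-a) := by
  rw [← Set.compl_Iic, probReal_compl_eq_one_sub measurableSet_Iic, ← cdf_eq_real,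
    cdf_expMeasure_eq one_pos, if_pos ha, one_mul]
  ring

lemma expMeasure_one_real_Ici {a : ℝ} (ha : 0 ≤ a) :
    (expMeasure 1).real (Set.Ici a) = Real.exp (-a) := by
  rw [← expMeasure_one_real_Ioi ha]
  exact measureReal_congr Ioi_ae_eq_Ici.symm

lemma integral_stepLaw (f : ℤ → ℝ) : ∫ s, f s ∂stepLaw = (f 1 + f (-1)) / 2 := by
  have hi : ∀ z : ℤ, Integrable f ((2⁻¹ : ℝ≥0∞) • Measure.dirac z) := fun z =>
    (integrable_dirac (by simp)).smul_measure (by simp)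
  rw [stepLaw, integral_add_measure (hi _) (hi _), integral_smul_measure, integral_smul_measure,
    integral_dirac, integral_dirac]
  simp only [ENNReal.toReal_inv, ENNReal.toReal_ofNat, smul_eq_mul]
  ring

lemma lt_waitingTime_iff {r t : ℝ} (hr : 0 < r) {m : Mark} :
    t < waitingTime r m ↔ t < m.1 ∧ t * r < m.2.1 := by
  by_cases h : JumpsFirst r m
  · have h' : m.1 * r < m.2.1 := h
    rw [waitingTime, if_pos h]
    exact ⟨fun h1 => ⟨h1, lt_trans (by gcongr) h'⟩, fun h1 => h1.1⟩
  · have h' : m.2.1 ≤ m.1 * r := not_lt.1 h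
    rw [waitingTime, if_neg h,lt_div_iff₀ hr]
    exact ⟨fun h1 => ⟨lt_of_mul_lt_mul_right (h1.trans_le h') hr.le, h1⟩, fun h1 => h1.2⟩

lemma integral_no_event {r t : ℝ} (hr : 0 < r) (ht : 0 ≤ t) :
    ∫ m, {m : Mark | t < m.1 ∧ t * r < m.2.1}.indicator 1 m ∂markLaw =
      Real.exp (-((1 + r) * t)) := by
  have : {m : Mark | t < m.1 ∧ t * r < m.2.1} =
      Set.Ioi t ×ˢ (Set.Ioi (t * r) ×ˢ (Set.univ : Set ℤ)) := by
    ext; simp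
  rw [this, integral_indicator_one
    (measurableSet_Ioi.prod (measurableSet_Ioi.prod MeasurableSet.univ)), markLaw,
    measureReal_prod_prod, measureReal_prod_prod, expMeasure_one_real_Ioi ht,
    expMeasure_one_real_Ioi (by positivity), probReal_univ, mul_one, ← Real.exp_add]
  ring_nf

/-- A jump at time `s` has density `exp (-s)`, and the branching clock is still silent with
probability `exp (-(r s))`. -/
lemma integral_jump {r t : ℝ} (hr : 0 < r) (ht : 0 ≤ t) {k : ℝ → ℤ → ℝ}
    (hk : Integrable (fun m : Mark => (Set.Iic t).indicator 1 m.1 *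
      ({m : Mark | m.1 * r < m.2.1}.indicator 1 m * k m.1 m.2.2)) markLaw) :
    ∫ m : Mark, (Set.Iic t).indicator 1 m.1 *
      ({m : Mark | m.1 * r < m.2.1}.indicator 1 m * k m.1 m.2.2) ∂markLaw =
      ∫ s in 0..t, Real.exp (-((1 + r) * s)) * ((k s 1 + k s (-1)) / 2) := by
  rw [markLaw] at hk ⊢
  rw [integral_prod _ hk, integral_expMeasure_one, intervalIntegral.integral_of_le ht]
  have h1 : Set.Ioc 0 t = Set.Ioi 0 ∩ Set.Iic t := rfl
  rw [h1, ← setIntegral_indicator measurableSet_Iic]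
  refine setIntegral_congr_fun measurableSet_Ioi fun s hs => ?_
  have hs : 0 < s := hs
  simp only
  rw [integral_const_mul]
  have h2 : ∫ p : ℝ × ℤ, {m : Mark | m.1 * r < m.2.1}.indicator 1 (s, p) * k s p.2
      ∂((expMeasure 1).prod stepLaw) = Real.exp (-(s * r)) * ((k s 1 + k s (-1)) / 2) := by
    have := integral_prod_mul (μ := expMeasure 1) (ν := stepLaw)
      ((Set.Ioi (s * r)).indicator (1 : ℝ → ℝ)) (k s)
    rw [integral_indicator_one measurableSet_Ioi, expMeasure_one_real_Ioi (by positivity),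
      integral_stepLaw] at this
    rw [← this]
    rfl
  rw [h2]
  simp only [Set.indicator]
  split_ifs
  · simp only [Pi.one_apply, one_mul]
    rw [← mul_assoc, ← Real.exp_add]
    ring_nf
  · simp

lemma integral_branch {r t : ℝ} (hr : 0 < r) (ht : 0 ≤ t) {k : ℝ → ℝ}
    (hk : Integrable (fun m : Mark => {m : Mark | m.2.1 ≤ m.1 * r}.indicator 1 m *
      ((Set.Iic t).indicator 1 (m.2.1 / r) * k (m.2.1 / r))) markLaw) :
    ∫ m : Mark, {m : Mark | m.2.1 ≤ m.1 * r}.indicator 1 m *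
      ((Set.Iic t).indicator 1 (m.2.1 / r) * k (m.2.1 / r)) ∂markLaw =
      ∫ s in 0..t, Real.exp (-((1 + r) * s)) * (r * k s) := by
  rw [markLaw] at hk ⊢
  -- The jump clock is integrated out first; the substitution `e = r s` then produces the factor
  -- `r`.
  rw [integral_prod_symm _ hk]
  have h1 : ∀ p : ℝ × ℤ, ∫ J : ℝ, {m : Mark | m.2.1 ≤ m.1 * r}.indicator 1 (J, p) *
      ((Set.Iic t).indicator 1 (p.1 / r) * k (p.1 / r)) ∂expMeasure 1 =
      (expMeasure 1).real (Set.Ici (p.1 / r)) *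
        ((Set.Iic t).indicator 1 (p.1 / r) * k (p.1 / r)) := fun p => by
    rw [integral_mul_const, ← integral_indicator_one measurableSet_Ici]
    congr 1
    refine integral_congr_ae (.of_forall fun J => ?_)
    simp only [Set.indicator, Set.mem_ofPred_eq, Set.mem_Ici, div_le_iff₀ hr]
    rfl
  simp only [h1]
  rw [integral_fun_fst (μ := expMeasure 1) (ν := stepLaw) (fun e : ℝ =>
    (expMeasure 1).real (Set.Ici (e / r)) * ((Set.Iic t).indicator 1 (e / r) * k (e / r))),
    probReal_univ, one_smul, integral_expMeasure_one]
  have h2 : ∫ s in 0..t, Real.exp (-((1 + r) * s)) * (r * k s) =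
      ∫ e in 0..(t * r), Real.exp (-((1 + r) * (e / r))) * k (e / r) := by
    rw [intervalIntegral.integral_comp_div (fun s => Real.exp (-((1 + r) * s)) * k s) hr.ne',
      zero_div, mul_div_cancel_right₀ _ hr.ne', smul_eq_mul,
      ← intervalIntegral.integral_const_mul]
    congr 1
    ext s
    ring
  have h3 : Set.Ioc 0 (t * r) = Set.Ioi 0 ∩ Set.Iic (t * r) := rfl
  rw [h2, intervalIntegral.integral_of_le (by positivity), h3,
    ← setIntegral_indicator measurableSet_Iic]
  refine setIntegral_congr_fun measurableSet_Ioi fun e he => ?_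
  have he : 0 < e := he
  simp only [Set.indicator, Set.mem_Iic, div_le_iff₀ hr,
    expMeasure_one_real_Ici (div_pos he hr).le]
  split_ifs
  · simp only [Pi.one_apply, one_mul]
    rw [← mul_assoc, ← Real.exp_add]
    congr 2
    field_simp
    ring
  · simp

open Classical in
lemma integral_renewal {h : ℝ → ℤ → ℝ} (hm : ∀ x, Measurable fun t => h t x)
    (h0 : ∀ t x, 0 ≤ h t x) (h1 : ∀ t x, h t x ≤ 1) {r t : ℝ} (hr : 0 < r) (ht : 0 ≤ t)
    (c : ℝ) (x : ℤ) :
    ∫ m, (if t < waitingTime r m then c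
      else if JumpsFirst r m then h (t - waitingTime r m) (x + m.2.2)
      else h (t - waitingTime r m) x ^ 2) ∂markLaw =
    Real.exp (-((1 + r) * t)) * (c + ∫ s in 0..t, Real.exp ((1 + r) * s) *
      ((h s (x + 1) + h s (x - 1)) / 2 + r * h s x ^ 2)) := by
  have hM1 : MeasurableSet {m : Mark | t < m.1 ∧ t * r < m.2.1} :=
    (measurableSet_lt measurable_const measurable_fst).inter
      (measurableSet_lt measurable_const (measurable_fst.comp measurable_snd))
  have hM2 : MeasurableSet {m : Mark | m.1 * r < m.2.1} := measurableSet_jumpsFirst r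
  have hM3 : MeasurableSet {m : Mark | m.2.1 ≤ m.1 * r} :=
    measurableSet_le (by fun_prop) (by fun_prop)
  have hMk : Measurable fun m : Mark => h (t - m.1) (x + m.2.2) := by
    have hk : Measurable fun p : ℝ × ℤ => h (t - p.1) (x + p.2) :=
      measurable_from_prod_countable_left fun z =>
        (hm (x + z)).comp (measurable_const.sub measurable_id)
    exact hk.comp (measurable_fst.prodMk (measurable_snd.comp measurable_snd))
  have hMb : Measurable fun m : Mark => h (t - m.2.1 / r) x ^ 2 :=
    ((hm x).comp (measurable_const.sub
      ((measurable_fst.comp measurable_snd).div_const r))).pow_const 2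
  have hi1 : Integrable ({m : Mark | t < m.1 ∧ t * r < m.2.1}.indicator (1 : Mark → ℝ)) markLaw :=
    (integrable_const 1).indicator hM1
  have hind : ∀ {α : Type} (s : Set α) (a : α), 0 ≤ s.indicator (1 : α → ℝ) a ∧
      s.indicator (1 : α → ℝ) a ≤ 1 := fun s a => by
    simp only [Set.indicator]; split_ifs <;> simp
  have hi2 : Integrable (fun m : Mark => (Set.Iic t).indicator 1 m.1 *
      ({m : Mark | m.1 * r < m.2.1}.indicator 1 m * h (t - m.1) (x + m.2.2))) markLaw := by
    refine Integrable.of_bound (C := 1) (Measurable.aestronglyMeasurable ?_)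
      (.of_forall fun m => ?_)
    · exact ((measurable_one.indicator measurableSet_Iic).comp measurable_fst).mul
        ((measurable_one.indicator hM2).mul hMk)
    · have e1 := hind (Set.Iic t) m.1
      have e2 := hind {m : Mark | m.1 * r < m.2.1} m
      have e3 := h0 (t - m.1) (x + m.2.2)
      rw [Real.norm_of_nonneg (mul_nonneg e1.1 (mul_nonneg e2.1 e3))]
      exact mul_le_one₀ e1.2 (mul_nonneg e2.1 e3) (mul_le_one₀ e2.2 e3 (h1 _ _))
  have hi3 : Integrable (fun m : Mark => {m : Mark | m.2.1 ≤ m.1 * r}.indicator 1 m *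
      ((Set.Iic t).indicator 1 (m.2.1 / r) * h (t - m.2.1 / r) x ^ 2)) markLaw := by
    refine Integrable.of_bound (C := 1) (Measurable.aestronglyMeasurable ?_)
      (.of_forall fun m => ?_)
    · exact (measurable_one.indicator hM3).mul
        (((measurable_one.indicator measurableSet_Iic).comp
          ((measurable_fst.comp measurable_snd).div_const r)).mul hMb)
    · have e1 := hind (Set.Iic t) (m.2.1 / r)
      have e2 := hind {m : Mark | m.2.1 ≤ m.1 * r} m
      have e3 := sq_nonneg (h (t - m.2.1 / r) x)
      rw [Real.norm_of_nonneg (mul_nonneg e2.1 (mul_nonneg e1.1 e3))]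
      exact mul_le_one₀ e2.2 (mul_nonneg e1.1 e3)
        (mul_le_one₀ e1.2 e3 (pow_le_one₀ (h0 _ _) (h1 _ _)))
  -- The three cases are no event by time `t`, a jump first, and a branching first.
  have hdec : ∀ m : Mark, (if t < waitingTime r m then c
      else if JumpsFirst r m then h (t - waitingTime r m) (x + m.2.2)
      else h (t - waitingTime r m) x ^ 2) =
      c * {m : Mark | t < m.1 ∧ t * r < m.2.1}.indicator 1 m +
      ((Set.Iic t).indicator 1 m.1 *
        ({m : Mark | m.1 * r < m.2.1}.indicator 1 m * h (t - m.1) (x + m.2.2)) +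
      {m : Mark | m.2.1 ≤ m.1 * r}.indicator 1 m *
        ((Set.Iic t).indicator 1 (m.2.1 / r) * h (t - m.2.1 / r) x ^ 2)) := by
    intro m
    by_cases hJ : JumpsFirst r m
    · have hJ' : m.1 * r < m.2.1 := hJ
      have hw : waitingTime r m = m.1 := by simp [waitingTime, hJ]
      simp only [← lt_waitingTime_iff hr, hw, Set.indicator, Set.mem_ofPred_eq, Set.mem_Iic, hJ,
        hJ', hJ'.not_ge, if_true, if_false, Pi.one_apply]
      by_cases h2 : t < m.1
      · simp [h2, h2.not_ge]
      · simp [h2, not_lt.1 h2]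
    · have hJ' : m.2.1 ≤ m.1 * r := not_lt.1 hJ
      have hw : waitingTime r m = m.2.1 / r := by simp [waitingTime, hJ]
      simp only [← lt_waitingTime_iff hr, hw, Set.indicator, Set.mem_ofPred_eq, Set.mem_Iic, hJ,
        hJ', hJ'.not_gt, if_true, if_false, Pi.one_apply]
      by_cases h2 : t < m.2.1 / r
      · simp [h2, h2.not_ge]
      · simp [h2, not_lt.1 h2]
  simp_rw [hdec]
  have hi23 := hi2.add hi3
  simp only [Pi.add_def] at hi23
  rw [integral_add (hi1.const_mul c) hi23, integral_add hi2 hi3, integral_const_mul,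
    integral_no_event hr ht, integral_jump hr ht (k := fun s z => h (t - s) (x + z)) hi2,
    integral_branch hr ht (k := fun s => h (t - s) x ^ 2) hi3,
    ← intervalIntegral.integral_add]
  rotate_left
  · have hk : Measurable fun s => (h (t - s) (x + 1) + h (t - s) (x + -1)) / 2 :=
      (((hm (x + 1)).comp (measurable_const.sub measurable_id)).add
        ((hm (x + -1)).comp (measurable_const.sub measurable_id))).div_const 2
    simpa only [neg_mul] using intervalIntegrable_exp_mul hk (C := 1) (fun s => by
      have e1 := h0 (t - s) (x + 1)
      have e2 := h0 (t - s) (x + -1)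
      have e3 := h1 (t - s) (x + 1)
      have e4 := h1 (t - s) (x + -1)
      rw [abs_le]; constructor <;> linarith) (-(1 + r)) 0 t
  · have hk : Measurable fun s => r * h (t - s) x ^ 2 :=
      (((hm x).comp (measurable_const.sub measurable_id)).pow_const 2).const_mul r
    simpa only [neg_mul] using intervalIntegrable_exp_mul hk (C := r) (fun s => by
      have e1 := pow_le_one₀ (n := 2) (h0 (t - s) x) (h1 (t - s) x)
      have e2 := sq_nonneg (h (t - s) x)
      rw [abs_of_nonneg (by positivity)]
      exact mul_le_of_le_one_right hr.le e1) (-(1 + r)) 0 t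
  -- Reversing time moves `t` out of the integrand, leaving `exp (-((1 + r) t))` times a primitive.
  have hsub := intervalIntegral.integral_comp_sub_left (a := 0) (b := t)
    (fun s => Real.exp (-((1 + r) * t)) * (Real.exp ((1 + r) * s) *
      ((h s (x + 1) + h s (x - 1)) / 2 + r * h s x ^ 2))) t
  rw [sub_self, sub_zero] at hsub
  rw [mul_add, ← intervalIntegral.integral_const_mul, ← hsub, mul_comm c]
  congr 2
  ext s
  rw [← mul_assoc (Real.exp _) (Real.exp _), ← Real.exp_add, ← mul_add]
  ring_nf

/-! ### From the renewal equation to the F-KPP equation -/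

lemma avoid_eq {ξ : ℤ → ℝ} {x : ℤ} (hξ : 0 < ξ x) (y : ℤ) {t : ℝ} (ht : 0 ≤ t) :
    avoid ξ y t x = Real.exp (-((1 + ξ x) * t)) * ((if y ≤ x then 0 else 1) +
      ∫ s in 0..t, Real.exp ((1 + ξ x) * s) *
        ((avoid ξ y s (x + 1) + avoid ξ y s (x - 1)) / 2 + ξ x * avoid ξ y s x ^ 2)) := by
  rw [avoid_eq_integral]
  exact integral_renewal (measurable_avoid ξ y) (avoid_nonneg ξ y) (avoid_le_one ξ y) hξ ht _ x

/-- The renewal equation gains regularity: the primitive of a merely bounded measurable integrand is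
continuous. -/
lemma continuousOn_avoid {ξ : ℤ → ℝ} {x : ℤ} (hξ : 0 < ξ x) (y : ℤ) :
    ContinuousOn (fun t => avoid ξ y t x) (Set.Ici 0) := by
  have hk : Measurable fun s =>
      (avoid ξ y s (x + 1) + avoid ξ y s (x - 1)) / 2 + ξ x * avoid ξ y s x ^ 2 :=
    (((measurable_avoid ξ y _).add (measurable_avoid ξ y _)).div_const 2).add
      (((measurable_avoid ξ y x).pow_const 2).const_mul _)
  have hc := intervalIntegral.continuous_primitive (μ := volume)
    (intervalIntegrable_exp_mul hk (C := 1 + ξ x) (fun s => by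
      have e1 := avoid_nonneg ξ y s (x + 1)
      have e2 := avoid_nonneg ξ y s (x - 1)
      have e3 := avoid_le_one ξ y s (x + 1)
      have e4 := avoid_le_one ξ y s (x - 1)
      have e5 := mul_le_of_le_one_right hξ.le
        (pow_le_one₀ (n := 2) (avoid_nonneg ξ y s x) (avoid_le_one ξ y s x))
      rw [abs_of_nonneg (by positivity)]
      linarith) (1 + ξ x)) 0
  have he : Continuous fun t => Real.exp (-((1 + ξ x) * t)) := by fun_prop
  exact (he.mul (continuous_const.add hc)).continuousOn.congr fun t ht => avoid_eq hξ y ht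

/-- The distribution function of the maximal particle solves the discrete F-KPP equation. -/
theorem isKPPSolution_w {ξ : ℤ → ℝ} (hξ : ∀ x, 0 < ξ x) (y : ℤ) : IsKPPSolution ξ (w ξ y) where
  nonneg t x := measureReal_nonneg
  le_one t x := measureReal_le_one
  hasDerivWithinAt t ht x := by
    -- Freezing negative times at `0` gives an integrand continuous on all of `ℝ`, so the
    -- fundamental theorem of calculus also applies at `t = 0`.
    have hc : ∀ z, Continuous fun s => avoid ξ y (max s 0) z := fun z =>
      (continuousOn_avoid (hξ z) y).comp_continuous (by fun_prop) fun s => le_max_right s 0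
    set F : ℝ → ℝ := fun s => Real.exp ((1 + ξ x) * s) *
      ((avoid ξ y (max s 0) (x + 1) + avoid ξ y (max s 0) (x - 1)) / 2 +
        ξ x * avoid ξ y (max s 0) x ^ 2) with hF
    have hFc : Continuous F := by
      have h1 := hc x
      have h2 := hc (x + 1)
      have h3 := hc (x - 1)
      fun_prop
    set c : ℝ := if y ≤ x then 0 else 1
    have heq : ∀ s, 0 ≤ s → w ξ y s x =
        1 - Real.exp (-((1 + ξ x) * s)) * (c + ∫ z in 0..s, F z) := fun s hs => by
      rw [w_eq_one_sub_avoid, avoid_eq (hξ x) y hs]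
      congr 3
      refine intervalIntegral.integral_congr fun z hz => ?_
      rw [Set.uIcc_of_le hs] at hz
      simp only [hF, max_eq_left hz.1]
    have hd1 : HasDerivAt (fun s => Real.exp (-((1 + ξ x) * s)))
        (Real.exp (-((1 + ξ x) * t)) * -(1 + ξ x)) t :=
      (((hasDerivAt_id' t).const_mul (1 + ξ x)).neg.exp).congr_deriv (by simp)
    have hd2 : HasDerivAt (fun s => c + ∫ z in 0..s, F z) (F t) t :=
      (hFc.integral_hasStrictDerivAt 0 t).hasDerivAt.const_add c
    have hd := ((hd1.mul hd2).const_sub 1).hasDerivWithinAt (s := Set.Ici 0)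
    refine (hd.congr (fun s hs => heq s hs) (heq t ht)).congr_deriv ?_
    have h1 : Real.exp (-((1 + ξ x) * t)) * (c + ∫ z in 0..t, F z) = 1 - w ξ y t x := by
      rw [heq t ht]; ring
    have h2 : Real.exp (-((1 + ξ x) * t)) * F t =
        (avoid ξ y t (x + 1) + avoid ξ y t (x - 1)) / 2 + ξ x * avoid ξ y t x ^ 2 := by
      simp only [hF, max_eq_left ht]
      rw [← mul_assoc, ← Real.exp_add, neg_add_cancel, Real.exp_zero, one_mul]
    rw [h2, mul_right_comm, h1]
    simp only [w_eq_one_sub_avoid]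
    ring

end BRW

/-! ### The random environment -/

theorem lemma4p3 {Ω : Type*} [MeasurableSpace Ω] (μ : Measure Ω) [IsProbabilityMeasure μ]
    (ξ : ℤ → Ω → ℝ)
    (hindep : iIndepFun ξ μ)
    (hident : ∀ x : ℤ, IdentDistrib (ξ x) (ξ 0) μ μ)
    (hpos : 0 < essInf (fun ω => (ξ 0 ω : EReal)) μ)
    (hnondeg : essInf (fun ω => (ξ 0 ω : EReal)) μ < essSup (fun ω => (ξ 0 ω : EReal)) μ)
    (hbdd : essSup (fun ω => (ξ 0 ω : EReal)) μ < ⊤) :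
    ∀ ε : ℝ, 0 < ε → ε < 1 / 2 →
      ∃ u : ℝ, 0 < u ∧
        ∀ᵐ ω ∂μ, ∀ t : ℝ, 0 ≤ t → ∀ y : ℤ,
          ε ≤ BRW.w (fun x => ξ x ω) y t 0 →
            ∀ t' : ℝ, u ≤ t' → 1 - ε ≤ BRW.w (fun x => ξ x ω) y (t + t') 0 := by
  intro ε hε hε'
  obtain ⟨r, hr0, hr⟩ := EReal.lt_iff_exists_real_btwn.1 hpos
  have hr0 : 0 < r := by exact_mod_cast hr0
  have hae0 : ∀ᵐ ω ∂μ, ξ 0 ω ∈ Set.Ioi r := by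
    filter_upwards [ae_lt_of_lt_essInf hr] with ω hω
    exact EReal.coe_lt_coe_iff.1 hω
  -- Equal laws transfer the bound to every site, and `ℤ` is countable.
  have hae : ∀ᵐ ω ∂μ, ∀ x, r < ξ x ω :=
    ae_all_iff.2 fun x => (hident x).symm.ae_mem_snd measurableSet_Ioi hae0
  obtain ⟨u, hu, h⟩ := BRW.exists_forall_isKPPSolution_le hr0 hε hε'
  refine ⟨u, hu, ?_⟩
  filter_upwards [hae] with ω hω t ht y hy t' ht'
  have hsol := BRW.isKPPSolution_w (ξ := fun x => ξ x ω) (fun x => hr0.trans (hω x)) y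
  exact h _ _ (fun x => (hω x).le) (hsol.shift ht) (by simpa using hy) t' ht'
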